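/- Let $B_n$ denote the Boolean lattice of all subsets of $[n]$ ordered by inclusion, and let $\mathcal B=\{B_n : n\ge 1\}$. A $t$-chain in a poset is a totally ordered subset of size $t$, and $h_p(t)$ denotes the number of $t$-chains in $B_p$. An induced copy of a poset $Q$ in a poset $P$ is the image of an injection $f:Q\to P$ with $f(x)\le f(y)$ if and only if $x\le y$. Let $\mathrm R^\sharp_{k,t}(\mathcal B\mid Q)$ be the smallest $N\ge 1$ such that for every coloring of the $t$-chains of $B_N$ with $k$ colors there is an induced copy of $Q$ in $B_N$ all of whose $t$-chains have the same color. Let $f_t^\sharp(n,p,q)$ be the minimum number of colors in a coloring of the $t$-chains of $B_n$ such that every induced copy of $B_p$ in $B_n$ uses at least $q$ colors on its $t$-chains. Let $p\ge 2$ and $1\le t\le p$ be fixed integers. Then there is a constant $c=c(p,2,t)>0$ such that, for all integers $n\ge p$, $$f_t^\sharp(n,p,2)\le c\cdot 2^{\frac{(n-p)\binom{p}{\lfloor p/2\rfloor}(1+o(1))}{h_p(t)-1}},\qquad o(1)\to 0\text{ as } n\to\infty.$$ For this constant $c$, and in fact for every fixed real $c>0$, as $k\to\infty$, $$\mathrm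 R^\sharp_{k,t}(\mathcal B\mid B_p)\ \ge\ p+\frac{(h_p(t)-1)\,(\log_2 k-\log_2 c)}{\binom{p}{\lfloor p/2\rfloor}\,(1+o(1))};$$ that is, there is a real sequence $(\varepsilon_k)$ with $\varepsilon_k\to 0$ such that, for all sufficiently large $k$, the number $\mathrm R^\sharp_{k,t}(\mathcal B\mid B_p)$ exists and the inequality holds with $\varepsilon_k$ in place of $o(1)$. -/

import Mathlib

open Filter Topology

/-- The Boolean lattice `B_n`: all subsets of an `n`-element set, ordered by inclusion. -/
abbrev BoolLat (n : ℕ) : Type := Finset (Fin n)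

/-- The `t`-chains of a poset: its totally ordered subsets of size `t`. -/
def TChain (P : Type) [PartialOrder P] (t : ℕ) : Type :=
  {C : Finset P // IsChain (· ≤ ·) (C : Set P) ∧ C.card = t}

/-- The set of those `t`-chains of `P` that lie inside `S ⊆ P`. -/
def tChainsIn {P : Type} [PartialOrder P] (t : ℕ) (S : Set P) : Set (TChain P t) :=
  {C | (C.1 : Set P) ⊆ S}

/-- `h_p(t)`: the number of `t`-chains in `B_p`. -/
noncomputable def numTChains (p t : ℕ) : ℕ := Nat.card (TChain (BoolLat p) t)

/-- `S` is an induced copy of `Q` in `P`: the image of a strong embedding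
(`f x ≤ f y` if and only if `x ≤ y`). -/
def IsInducedCopy (Q : Type) [PartialOrder Q] {P : Type} [PartialOrder P] (S : Set P) : Prop :=
  ∃ f : Q ↪o P, Set.range f = S

/-- Every `k`-coloring of the `t`-chains of `B_n` has a monochromatic induced copy of `Q`,
that is, an induced copy of `Q` all of whose `t`-chains have the same color `i`. -/
def IsStrongRamsey (k t : ℕ) (Q : Type) [PartialOrder Q] (n : ℕ) : Prop :=
  ∀ χ : TChain (BoolLat n) t → Fin k,
    ∃ i : Fin k, ∃ S : Set (BoolLat n), IsInducedCopy Q S ∧ ∀ C ∈ tChainsIn t S, χ C = i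

/-- The strong Boolean Ramsey number `R^♯_{k,t}(𝓑 | Q)` for the host family
`𝓑 = {B_n : n ≥ 1}`: the smallest `N ≥ 1` such that every `k`-coloring of the `t`-chains of
`B_N` has a monochromatic induced copy of `Q`. (If there were no such `N`, the value would be
`0`, so a positive lower bound on this number includes its existence.) -/
noncomputable def strongBooleanRamsey (k t : ℕ) (Q : Type) [PartialOrder Q] : ℕ :=
  sInf {N : ℕ | 1 ≤ N ∧ IsStrongRamsey k t Q N}

/-- A strong `(p,q,t)`-coloring of `B_n` with `k` available colors: every induced copy of `B_p`
uses at least `q` colors on its `t`-chains. -/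
def IsStrongColoring (p q t : ℕ) {n k : ℕ} (χ : TChain (BoolLat n) t → Fin k) : Prop :=
  ∀ S : Set (BoolLat n), IsInducedCopy (BoolLat p) S → q ≤ (χ '' tChainsIn t S).ncard

/-- `f_t^♯(n,p,q)`: the minimum number of colors in a strong `(p,q,t)`-coloring of `B_n`. -/
noncomputable def minStrongColors (t n p q : ℕ) : ℕ :=
  sInf {k : ℕ | ∃ χ : TChain (BoolLat n) t → Fin k, IsStrongColoring p q t χ}

/-- `c > 0` is an admissible constant `c(p,q,t)`: for all `n ≥ p`,
`f_t^♯(n,p,q) ≤ c * 2 ^ ((n - p) * C(p, ⌊p/2⌋) * (1 + o(1)) / (h_p(t) - q + 1))`,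
where `o(1) → 0` as `n → ∞`. -/
def IsColoringConstant (p q t : ℕ) (c : ℝ) : Prop :=
  0 < c ∧ ∃ δ : ℕ → ℝ, Tendsto δ atTop (𝓝 0) ∧ ∀ n : ℕ, p ≤ n →
    (minStrongColors t n p q : ℝ) ≤
      c * (2 : ℝ) ^ (((n : ℝ) - (p : ℝ)) * (p.choose (p / 2) : ℝ) * (1 + δ n) /
        ((numTChains p t : ℝ) - (q : ℝ) + 1))

/-! Color a `t`-chain of `B_n` by the set of cardinalities of its members. This uses at most
`(n + 1) ^ t` colors. An induced copy of `B_p` contains a chain of `p + 1` members with distinct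
cardinalities, and because `1 ≤ t ≤ p` this chain has two different `t`-subsets, which get different
colors (`exists_isStrongColoring`). So `f_t^♯(n, p, 2)` is at most polynomial in `n`
(`minStrongColors_le`), which is below any exponential with positive rate up to a constant; the rate
is positive because `h_p(t) ≥ 2` (`two_le_numTChains`). The `o(1)` terms may therefore be taken to
be `0` in both parts.

For the Ramsey number the same coloring shows that `B_n` fails the Ramsey property when
`(n + 1) ^ t ≤ k`, so a finite `R` satisfies `k < (R + 1) ^ t`
(`lt_strongBooleanRamsey_succ_pow`), which is much stronger than a lower bound logarithmic in `k`.

The remaining point is that `R` exists (`exists_isStrongRamsey`). The lattice `B_p` embeds into a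
grid `{0, …, 2 p + 1}^p` so that all coordinates are strictly monotone, and grids `{0, …, M - 1}^p`
embed into `B_{pM}`. A `t`-chain of the resulting copy is a list of `p` increasing `t`-tuples, one
per coordinate. Placing the coordinates in consecutive blocks of a single homogeneous set turns it
into one increasing `p * t`-tuple, so Ramsey's theorem for `p * t`-tuples
(`exists_strictMono_homogeneous`) gives a monochromatic copy. -/

/-! ### The finite Ramsey theorem -/

/-- Finite Ramsey theorem for `r`-subsets, for an arbitrary finite palette. -/
theorem exists_homogeneous_finset (α : Type) [Finite α] [Nonempty α] (r m : ℕ) :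
    ∃ M : ℕ, ∀ X : Finset ℕ, M ≤ X.card → ∀ χ : Finset ℕ → α,
      ∃ H ⊆ X, H.card = m ∧ ∃ i, ∀ S ⊆ H, S.card = r → χ S = i := by
  classical
  have := Fintype.ofFinite α
  induction r generalizing m with
  | zero =>
    refine ⟨m, fun X hX χ => ?_⟩
    obtain ⟨H, hH, hc⟩ := Finset.exists_subset_card_eq hX
    exact ⟨H, hH, hc, χ ∅, fun S _ hS => by rw [Finset.card_eq_zero.1 hS]⟩
  | succ r ih =>
    -- On `H` the color of an `(r+1)`-set depends only on one of its elements,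
    -- the one that was split off first.
    have key : ∀ m : ℕ, ∃ M : ℕ, ∀ (X : Finset ℕ), M ≤ X.card → ∀ χ : Finset ℕ → α,
        ∃ H ⊆ X, H.card = m ∧ ∃ c : ℕ → α,
          ∀ S ⊆ H, S.card = r + 1 → ∃ x ∈ S, χ S = c x := by
      intro m
      induction m with
      | zero =>
        refine ⟨0, fun X _ χ => ⟨∅, by simp, rfl, fun _ => Classical.arbitrary α, ?_⟩⟩
        intro S hS hc
        rw [Finset.subset_empty.1 hS] at hc
        simp at hc
      | succ m ihm =>
        obtain ⟨M₁, hM₁⟩ := ihm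
        obtain ⟨M₂, hM₂⟩ := ih M₁
        refine ⟨M₂ + 1, fun X hX χ => ?_⟩
        obtain ⟨x, hx⟩ : X.Nonempty := Finset.card_pos.1 (by omega)
        obtain ⟨Y, hY, hYc, i, hi⟩ := hM₂ (X.erase x) (by rw [Finset.card_erase_of_mem hx]; omega)
          (fun S => χ (insert x S))
        obtain ⟨H, hH, hHc, c, hc⟩ := hM₁ Y hYc.ge χ
        have hHX : H ⊆ X.erase x := hH.trans hY
        have hxH : x ∉ H := fun h => by simpa using hHX h
        refine ⟨insert x H, Finset.insert_subset hx (hHX.trans (Finset.erase_subset _ _)),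
          by rw [Finset.card_insert_of_notMem hxH, hHc], Function.update c x i, ?_⟩
        intro S hS hSc
        by_cases hxS : x ∈ S
        · refine ⟨x, hxS, ?_⟩
          have h := hi (S.erase x) ((Finset.subset_insert_iff.1 hS).trans hH) (by
            rw [Finset.card_erase_of_mem hxS]; omega)
          simpa [Finset.insert_erase hxS] using h
        · have hSH : S ⊆ H := (Finset.subset_insert_iff_of_notMem hxS).1 hS
          obtain ⟨y, hy, h⟩ := hc S hSH hSc
          exact ⟨y, hy, by rw [h, Function.update_of_ne (by rintro rfl; exact hxS hy)]⟩
    obtain ⟨M, hM⟩ := key (Fintype.card α * m)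
    refine ⟨M, fun X hX χ => ?_⟩
    obtain ⟨H, hH, hHc, c, hc⟩ := hM X hX χ
    obtain ⟨i, -, hi⟩ := Finset.exists_le_card_fiber_of_mul_le_card_of_maps_to
      (s := H) (t := Finset.univ) (f := c) (n := m) (fun _ _ => Finset.mem_univ _)
      Finset.univ_nonempty (by rw [Finset.card_univ, hHc])
    obtain ⟨K, hK, hKc⟩ := Finset.exists_subset_card_eq hi
    refine ⟨K, hK.trans ((Finset.filter_subset _ _).trans hH), hKc, i, fun S hS hSc => ?_⟩
    obtain ⟨x, hx, h⟩ := hc S (hS.trans (hK.trans (Finset.filter_subset _ _))) hSc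
    rw [h]
    exact (Finset.mem_filter.1 (hK (hS hx))).2

/-- Ramsey's theorem for colorings of increasing `r`-tuples. -/
theorem exists_strictMono_homogeneous (α : Type) [Finite α] [Nonempty α] (r m : ℕ) :
    ∃ M : ℕ, ∀ χ : (Fin r → ℕ) → α, ∃ e : Fin m → ℕ, StrictMono e ∧ (∀ a, e a < M) ∧
      ∃ i, ∀ y : Fin r → Fin m, StrictMono y → χ (e ∘ y) = i := by
  classical
  obtain ⟨M, hM⟩ := exists_homogeneous_finset α r m
  refine ⟨M, fun χ => ?_⟩
  obtain ⟨H, hH, hHc, i, hi⟩ := hM (Finset.range M) (by simp)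
    (fun S => if h : S.card = r then χ (S.orderEmbOfFin h) else Classical.arbitrary α)
  refine ⟨H.orderEmbOfFin hHc, (H.orderEmbOfFin hHc).strictMono,
    fun a => Finset.mem_range.1 (hH (H.orderEmbOfFin_mem hHc a)), i, fun y hy => ?_⟩
  have hmono := (H.orderEmbOfFin hHc).strictMono.comp hy
  set S := Finset.univ.image (H.orderEmbOfFin hHc ∘ y)
  have hS : S.card = r := by
    rw [Finset.card_image_of_injective _ hmono.injective, Finset.card_univ, Fintype.card_fin]
  have h := hi S (by
    intro z hz
    obtain ⟨a, -, rfl⟩ := Finset.mem_image.1 hz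
    exact H.orderEmbOfFin_mem hHc _) hS
  rw [dif_pos hS] at h
  rw [← h]
  exact congrArg χ (Finset.orderEmbOfFin_unique hS
    (fun a => Finset.mem_image_of_mem _ (Finset.mem_univ a)) hmono)

/-! ### Existence of the Ramsey number -/

theorem injOn_card_of_isChain {α : Type} {C : Set (Finset α)} (hC : IsChain (· ≤ ·) C) :
    Set.InjOn Finset.card C := by
  intro A hA B hB h
  rcases hC.total hA hB with h' | h'
  · exact Finset.eq_of_subset_of_card_le h' h.ge
  · exact (Finset.eq_of_subset_of_card_le h' h.le).symm

/-- A chain of `t` elements in `BoolLat p` can be listed increasingly. -/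
theorem exists_strictMono_image_eq {p t : ℕ} (C : Finset (BoolLat p))
    (hC : IsChain (· ≤ ·) (C : Set (BoolLat p))) (ht : C.card = t) :
    ∃ a : Fin t → BoolLat p, StrictMono a ∧ Finset.univ.image a = C := by
  classical
  -- On a chain the cardinality is injective, and it is inverted along its sorted set of values.
  have hlt : ∀ A ∈ C, ∀ B ∈ C, A.card < B.card → A < B := by
    intro A hA B hB h
    rcases hC.total hA hB with h' | h'
    · exact lt_of_le_of_ne h' (by rintro rfl; exact lt_irrefl _ h)
    · exact absurd (Finset.card_le_card h') (by omega)
  have hcard : (C.image Finset.card).card = t := by 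
    rw [Finset.card_image_of_injOn (injOn_card_of_isChain hC), ht]
  choose a ha hac using fun l => Finset.mem_image.1 ((C.image Finset.card).orderEmbOfFin_mem hcard l)
  have hmono : StrictMono a := fun l l' h => hlt _ (ha l) _ (ha l') (by
    rw [hac, hac]; exact ((C.image Finset.card).orderEmbOfFin hcard).strictMono h)
  refine ⟨a, hmono, Finset.eq_of_subset_of_card_le ?_ ?_⟩
  · intro A hA
    obtain ⟨l, -, rfl⟩ := Finset.mem_image.1 hA
    exact ha l
  · rw [Finset.card_image_of_injective _ hmono.injective, ht]; simp

/-- The point `x` of the grid `{0, …, M - 1}^d`, encoded as an element of `BoolLat (d * M)`: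
the concatenation of the `d` initial segments `{0, …, x j}`. -/
def gridPoint (d M : ℕ) (x : Fin d → ℕ) : BoolLat (d * M) :=
  Finset.univ.filter fun a => ((finProdFinEquiv.symm a).2 : ℕ) ≤ x (finProdFinEquiv.symm a).1

theorem gridPoint_le_iff {d M : ℕ} {x y : Fin d → ℕ} (hx : ∀ j, x j < M) :
    gridPoint d M x ≤ gridPoint d M y ↔ x ≤ y := by
  constructor
  · intro h j
    have hmem : finProdFinEquiv (j, (⟨x j, hx j⟩ : Fin M)) ∈ gridPoint d M x := by
      simp only [gridPoint, Finset.mem_filter, Finset.mem_univ, true_and,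
        Equiv.symm_apply_apply, le_refl]
    simpa only [gridPoint, Finset.mem_filter, Finset.mem_univ, true_and,
      Equiv.symm_apply_apply] using h hmem
  · intro h a ha
    simp only [gridPoint, Finset.mem_filter, Finset.mem_univ, true_and] at ha ⊢
    exact ha.trans (h _)

/-- Coordinate `j` of an embedding of `BoolLat p` into the grid `{0, …, 2 * p + 1}^p`. Every
coordinate is strictly monotone, so a `t`-chain has `t` distinct values in each of them. -/
def coord {p : ℕ} (j : Fin p) (A : BoolLat p) : Fin (2 * p + 2) :=
  ⟨A.card + if j ∈ A then p + 1 else 0, by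
    have := Finset.card_le_univ A
    rw [Fintype.card_fin] at this
    split_ifs <;> omega⟩

theorem coord_strictMono {p : ℕ} (j : Fin p) : StrictMono (coord j) := by
  intro A B h
  have h1 := Finset.card_lt_card h
  have h2 : j ∈ A → j ∈ B := fun hj => h.1 hj
  simp only [coord, Fin.mk_lt_mk]
  split_ifs <;> first | omega | (exfalso; tauto)

theorem le_iff_forall_coord_le {p : ℕ} {A B : BoolLat p} :
    A ≤ B ↔ ∀ j, coord j A ≤ coord j B := by
  refine ⟨fun h j => (coord_strictMono j).monotone h, fun h j hj => ?_⟩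
  by_contra hjB
  have h1 := h j
  have h2 := Finset.card_le_univ B
  rw [Fintype.card_fin] at h2
  simp only [coord, hj, hjB, if_true, if_false, Fin.mk_le_mk] at h1
  omega

theorem finProdFinEquiv_lt_iff {m n : ℕ} {a b : Fin m × Fin n} :
    finProdFinEquiv a < finProdFinEquiv b ↔ a.1 < b.1 ∨ a.1 = b.1 ∧ a.2 < b.2 := by
  obtain ⟨⟨i, hi⟩, ⟨j, hj⟩⟩ := a
  obtain ⟨⟨i', hi'⟩, ⟨j', hj'⟩⟩ := b
  simp only [finProdFinEquiv, Equiv.coe_fn_mk, Fin.mk_lt_mk, Fin.mk.injEq]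
  rcases lt_trichotomy i i' with h | rfl | h
  · have : n * (i + 1) ≤ n * i' := Nat.mul_le_mul_left _ h
    rw [Nat.mul_succ] at this
    simp only [h, true_or, iff_true]; omega
  · simp
  · have : n * (i' + 1) ≤ n * i := Nat.mul_le_mul_left _ h
    rw [Nat.mul_succ] at this
    simp only [h.not_gt, h.ne', false_and, or_self, iff_false]; omega

/-- Every palette with at least one color admits an `N` with the Ramsey property for `BoolLat p`:
Ramsey's theorem for `p * t`-tuples makes all products of `t`-subsets in `p` consecutive blocks of a
homogeneous set equally colored, and the `t`-chains of the copy given by `coord` are of this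
form. -/
theorem exists_isStrongRamsey (p k t : ℕ) (hk : 0 < k) (hp : 0 < p) :
    ∃ N, 1 ≤ N ∧ IsStrongRamsey k t (BoolLat p) N := by
  classical
  have : Nonempty (Fin k) := ⟨⟨0, hk⟩⟩
  obtain ⟨M, hM⟩ := exists_strictMono_homogeneous (Fin k) (p * t) (p * (2 * p + 2))
  have hMpos : 0 < M := by
    obtain ⟨e, -, he, -⟩ := hM (fun _ => ⟨0, hk⟩)
    exact (Nat.zero_le _).trans_lt (he ⟨0, by positivity⟩)
  refine ⟨p * M, Nat.mul_pos hp hMpos, fun χ => ?_⟩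
  -- `T y` reads a `p * t`-tuple as `p` blocks of length `t`; the `l`-th entries of the blocks are
  -- the coordinates of its `l`-th grid point.
  let T : (Fin (p * t) → ℕ) → Finset (BoolLat (p * M)) := fun y =>
    Finset.univ.image fun l : Fin t => gridPoint p M fun j => y (finProdFinEquiv (j, l))
  obtain ⟨e, he, heM, i, hi⟩ := hM fun y =>
    if h : IsChain (· ≤ ·) (T y : Set (BoolLat (p * M))) ∧ (T y).card = t then χ ⟨T y, h⟩
    else ⟨0, hk⟩
  have hblock : ∀ j : Fin p, StrictMono fun b : Fin (2 * p + 2) => e (finProdFinEquiv (j, b)) :=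
    fun j b b' h => he (finProdFinEquiv_lt_iff.2 (Or.inr ⟨rfl, h⟩))
  let f : BoolLat p ↪o BoolLat (p * M) :=
    OrderEmbedding.ofMapLEIff
      (fun A => gridPoint p M fun j => e (finProdFinEquiv (j, coord j A))) (by
        intro A B
        rw [gridPoint_le_iff fun j => heM _, Pi.le_def, le_iff_forall_coord_le]
        exact forall_congr' fun j => (hblock j).le_iff_le)
  refine ⟨i, Set.range f, ⟨f, rfl⟩, fun C hC => ?_⟩
  obtain ⟨C, hchain, hcard⟩ := C
  change (C : Set _) ⊆ Set.range f at hC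
  obtain ⟨D, rfl⟩ : ∃ D : Finset (BoolLat p), D.image f = C := by
    rw [← Set.image_univ] at hC
    obtain ⟨D, -, h⟩ := Finset.subset_set_image_iff.1 hC
    exact ⟨D, h⟩
  obtain ⟨a, ha, haD⟩ := exists_strictMono_image_eq (t := t) D (by
    intro A hA B hB hAB
    have h := hchain (Finset.mem_coe.2 (Finset.mem_image_of_mem f hA))
      (Finset.mem_coe.2 (Finset.mem_image_of_mem f hB)) (f.injective.ne hAB)
    simpa only [f.le_iff_le] using h) (by rwa [Finset.card_image_of_injective _ f.injective] at hcard)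
  let y : Fin (p * t) → Fin (p * (2 * p + 2)) := fun q =>
    finProdFinEquiv ((finProdFinEquiv.symm q).1,
      coord (finProdFinEquiv.symm q).1 (a (finProdFinEquiv.symm q).2))
  have hy : StrictMono y := by
    intro q q' h
    rw [← finProdFinEquiv.apply_symm_apply q, ← finProdFinEquiv.apply_symm_apply q',
      finProdFinEquiv_lt_iff] at h
    refine finProdFinEquiv_lt_iff.2 ?_
    rcases h with h | ⟨h, h'⟩
    · exact Or.inl h
    · refine Or.inr ⟨h, ?_⟩
      simp only [← h]
      exact coord_strictMono _ (ha h')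
  have hT : T (e ∘ y) = D.image f := by
    rw [← haD, Finset.image_image]
    simp only [T, y, Function.comp_apply, Equiv.symm_apply_apply]
    rfl
  have h := hi y hy
  rw [dif_pos (by rw [hT]; exact ⟨hchain, hcard⟩)] at h
  rw [← h]
  congr 1
  exact Subtype.ext hT.symm

/-! ### The level coloring -/

theorem one_lt_choose_succ {p t : ℕ} (ht : 1 ≤ t) (htp : t ≤ p) : 1 < (p + 1).choose t := by
  obtain ⟨s, rfl⟩ := Nat.exists_eq_add_of_le' ht
  rw [Nat.choose_succ_succ']
  have h1 := Nat.choose_pos (n := p) (k := s) (by omega)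
  have h2 := Nat.choose_pos htp
  omega

/-- Coloring a `t`-chain by the set of cardinalities of its members takes at most
`(n + 1).choose t` colors, and sees two colors on every induced copy of `BoolLat p`: the members of
a maximal chain of the copy have `p + 1` distinct cardinalities, so distinct `t`-subsets of
it get distinct colors. -/
theorem exists_isStrongColoring {p t : ℕ} (ht : 1 ≤ t) (htp : t ≤ p) {n k : ℕ}
    (hk : (n + 1).choose t ≤ k) :
    ∃ χ : TChain (BoolLat n) t → Fin k, IsStrongColoring p 2 t χ := by
  classical
  let lev : TChain (BoolLat n) t → Finset.powersetCard t (Finset.range (n + 1)) := fun C =>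
    ⟨C.1.image Finset.card, Finset.mem_powersetCard.2 ⟨by
      intro z hz
      obtain ⟨A, -, rfl⟩ := Finset.mem_image.1 hz
      have := Finset.card_le_univ A
      rw [Fintype.card_fin] at this
      exact Finset.mem_range.2 (by omega), by
      rw [Finset.card_image_of_injOn (injOn_card_of_isChain C.2.1), C.2.2]⟩⟩
  obtain ⟨g⟩ : Nonempty (Finset.powersetCard t (Finset.range (n + 1)) ↪ Fin k) :=
    Function.Embedding.nonempty_of_card_le (by simpa using hk)
  refine ⟨fun C => g (lev C), ?_⟩
  rintro S ⟨f, rfl⟩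
  -- The maximal chain `∅ ⊂ {0} ⊂ {0, 1} ⊂ ⋯` of `BoolLat p`.
  let A : Fin (p + 1) → BoolLat p := fun i => Finset.univ.filter fun x => (x : ℕ) < i
  have hA : StrictMono A := by
    intro i j h
    refine Finset.ssubset_iff_subset_ne.2 ⟨fun x hx => ?_, fun heq => ?_⟩
    · simp only [A, Finset.mem_filter, Finset.mem_univ, true_and] at hx ⊢
      exact hx.trans h
    · have hx : (⟨i, lt_of_lt_of_le h (Nat.lt_succ_iff.1 j.2)⟩ : Fin p) ∈ A j := by
        simpa [A] using h
      rw [← heq] at hx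
      simp [A] at hx
  have hfA : StrictMono (f ∘ A) := f.strictMono.comp hA
  have hcardA : StrictMono fun i => (f (A i)).card := fun i j h => Finset.card_lt_card (hfA h)
  let chain : ∀ I : Finset (Fin (p + 1)), I.card = t → TChain (BoolLat n) t := fun I hI =>
    ⟨I.image (f ∘ A), by
      intro X hX Y hY _
      obtain ⟨i, -, rfl⟩ := Finset.mem_image.1 (Finset.mem_coe.1 hX)
      obtain ⟨j, -, rfl⟩ := Finset.mem_image.1 (Finset.mem_coe.1 hY)
      exact (le_total i j).imp (fun h => hfA.monotone h) fun h => hfA.monotone h,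
      by rw [Finset.card_image_of_injective _ hfA.injective, hI]⟩
  have hchain : ∀ I hI, g (lev (chain I hI)) ∈
      (fun C => g (lev C)) '' tChainsIn t (Set.range f) := by
    intro I hI
    refine ⟨_, ?_, rfl⟩
    intro X hX
    obtain ⟨i, -, rfl⟩ := Finset.mem_image.1 (Finset.mem_coe.1 hX)
    exact ⟨_, rfl⟩
  obtain ⟨I, hI, J, hJ, hIJ⟩ := Finset.one_lt_card.1
    (show 1 < (Finset.powersetCard t (Finset.univ : Finset (Fin (p + 1)))).card by
      simpa using one_lt_choose_succ ht htp)
  have hI := (Finset.mem_powersetCard.1 hI).2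
  have hJ := (Finset.mem_powersetCard.1 hJ).2
  refine Nat.succ_le_of_lt ((Set.one_lt_ncard (Set.toFinite _)).2
    ⟨_, hchain I hI, _, hchain J hJ, fun h => hIJ ?_⟩)
  have h := congrArg Subtype.val (g.injective h)
  simp only [lev, chain, Finset.image_image] at h
  exact Finset.image_injective hcardA.injective h

theorem not_isStrongRamsey_of_isStrongColoring {p t n k : ℕ} {χ : TChain (BoolLat n) t → Fin k}
    (hχ : IsStrongColoring p 2 t χ) : ¬ IsStrongRamsey k t (BoolLat p) n := by
  intro h
  obtain ⟨i, S, hS, hi⟩ := h χ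
  have h1 : χ '' tChainsIn t S ⊆ {i} := by
    rintro _ ⟨C, hC, rfl⟩
    exact hi C hC
  have h2 := Set.ncard_le_ncard h1 (Set.finite_singleton i)
  rw [Set.ncard_singleton] at h2
  have := hχ S hS
  omega

theorem minStrongColors_le {p t : ℕ} (ht : 1 ≤ t) (htp : t ≤ p) (n : ℕ) :
    minStrongColors t n p 2 ≤ (n + 1) ^ t :=
  Nat.sInf_le (exists_isStrongColoring ht htp (Nat.choose_le_pow _ _))

/-- The level coloring rules out monochromatic copies in `BoolLat n` as soon as `(n + 1) ^ t ≤ k`.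
Existence of the Ramsey number enters because the infimum of an empty set would be `0`. -/
theorem lt_strongBooleanRamsey_succ_pow {p t k : ℕ} (hk : 0 < k) (ht : 1 ≤ t) (htp : t ≤ p) :
    k < (strongBooleanRamsey k t (BoolLat p) + 1) ^ t := by
  by_contra! h
  have hmem : strongBooleanRamsey k t (BoolLat p) ∈
      {N : ℕ | 1 ≤ N ∧ IsStrongRamsey k t (BoolLat p) N} :=
    Nat.sInf_mem (exists_isStrongRamsey p k t hk (by omega))
  obtain ⟨χ, hχ⟩ := exists_isStrongColoring ht htp ((Nat.choose_le_pow _ _).trans h)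
  exact not_isStrongRamsey_of_isStrongColoring hχ hmem.2

/-- The identity copy of `BoolLat p` in itself already sees two colors of the level coloring. -/
theorem two_le_numTChains {p t : ℕ} (ht : 1 ≤ t) (htp : t ≤ p) : 2 ≤ numTChains p t := by
  have : Finite (TChain (BoolLat p) t) :=
    inferInstanceAs (Finite {C : Finset (BoolLat p) // _})
  obtain ⟨χ, hχ⟩ := exists_isStrongColoring (n := p) ht htp le_rfl
  refine (hχ Set.univ ⟨RelEmbedding.refl _, by ext; simp⟩).trans ?_
  exact (Set.ncard_image_le (Set.toFinite _)).trans (Set.ncard_le_card _)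

/-! ### Asymptotics -/

theorem exists_pow_le_mul_two_rpow (t p : ℕ) {a : ℝ} (ha : 0 < a) :
    ∃ c : ℝ, 0 < c ∧ ∀ n : ℕ, ((n : ℝ) + 1) ^ t ≤ c * (2 : ℝ) ^ (((n : ℝ) - p) * a) := by
  set r : ℝ := (2 : ℝ) ^ (-a)
  have hr : 0 < r := Real.rpow_pos_of_pos two_pos _
  have hr1 : r < 1 := Real.rpow_lt_one_of_one_lt_of_neg one_lt_two (by linarith)
  have hlim := (tendsto_pow_const_mul_const_pow_of_abs_lt_one t
    (abs_lt.2 ⟨by linarith, hr1⟩)).comp (tendsto_add_atTop_nat 1)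
  obtain ⟨b, hb⟩ := hlim.bddAbove_range
  have hb' : ∀ n : ℕ, ((n : ℝ) + 1) ^ t * r ^ (n + 1) ≤ b := fun n => by
    simpa using hb ⟨n, rfl⟩
  have hb0 : 0 < b := lt_of_lt_of_le (by positivity) (hb' 0)
  refine ⟨b * (2 : ℝ) ^ ((1 + p) * a), by positivity, fun n => ?_⟩
  have hrn : r ^ (n + 1) * (2 : ℝ) ^ (((n : ℝ) + 1) * a) = 1 := by
    rw [← Real.rpow_natCast, ← Real.rpow_mul zero_le_two, ← Real.rpow_add two_pos]
    push_cast
    rw [show -a * ((n : ℝ) + 1) + (n + 1) * a = 0 by ring, Real.rpow_zero]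
  calc ((n : ℝ) + 1) ^ t
      = ((n : ℝ) + 1) ^ t * r ^ (n + 1) * (2 : ℝ) ^ (((n : ℝ) + 1) * a) := by
        rw [mul_assoc, hrn, mul_one]
    _ ≤ b * (2 : ℝ) ^ (((n : ℝ) + 1) * a) := by gcongr; exact hb' n
    _ = b * (2 : ℝ) ^ ((1 + p) * a) * (2 : ℝ) ^ (((n : ℝ) - p) * a) := by
        rw [mul_assoc, ← Real.rpow_add two_pos]
        congr 2
        ring

theorem eventually_add_mul_log_le_rpow (A B : ℝ) {s : ℝ} (hs : 0 < s) :
    ∀ᶠ k : ℕ in atTop, A + B * Real.log k ≤ (k : ℝ) ^ s := by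
  have h1 := ((isLittleO_log_rpow_atTop hs).const_mul_left B).add
    (Asymptotics.isLittleO_const_left.2 (Or.inr
      (tendsto_norm_atTop_atTop.comp (tendsto_rpow_atTop hs))) :
      (fun _ : ℝ => A) =o[atTop] fun x : ℝ => x ^ s)
  have h2 := (h1.bound one_pos).and (eventually_ge_atTop 0)
  filter_upwards [tendsto_natCast_atTop_atTop.eventually h2] with k hk
  have h3 := (le_abs_self _).trans hk.1
  rw [one_mul, Real.norm_of_nonneg (Real.rpow_nonneg hk.2 _)] at h3
  linarith

/-- For `p ≥ 2` and `1 ≤ t ≤ p`, the constant `c(p,2,t)` exists, and for it (in fact for every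
fixed `c > 0`), as `k → ∞`,
`R^♯_{k,t}(𝓑 | B_p) ≥ p + (h_p(t) - 1) (log₂ k - log₂ c) / (C(p, ⌊p/2⌋) (1 + o(1)))`. -/
theorem corollary5p2 (p t : ℕ) (hp : 2 ≤ p) (ht : 1 ≤ t) (htp : t ≤ p) :
    (∃ c : ℝ, IsColoringConstant p 2 t c) ∧
    ∀ c : ℝ, 0 < c →
      ∃ ε : ℕ → ℝ, Tendsto ε atTop (𝓝 0) ∧
        ∀ᶠ k : ℕ in atTop,
          (p : ℝ) + ((numTChains p t : ℝ) - 1) * (Real.logb 2 (k : ℝ) - Real.logb 2 c) /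
              ((p.choose (p / 2) : ℝ) * (1 + ε k))
            ≤ (strongBooleanRamsey k t (BoolLat p) : ℝ) := by

  have hh : (0 : ℝ) < (numTChains p t : ℝ) - 1 := by
    have : (2 : ℝ) ≤ numTChains p t := by exact_mod_cast two_le_numTChains ht htp
    linarith
  have hC : (0 : ℝ) < (p.choose (p / 2) : ℝ) := by
    exact_mod_cast Nat.choose_pos (Nat.div_le_self p 2)
  constructor
  · obtain ⟨c, hc, hbound⟩ := exists_pow_le_mul_two_rpow t p (div_pos hC hh)
    refine ⟨c, hc, fun _ => 0, tendsto_const_nhds, fun n _ => ?_⟩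
    calc (minStrongColors t n p 2 : ℝ) ≤ ((n : ℝ) + 1) ^ t := by
          exact_mod_cast minStrongColors_le ht htp n
      _ ≤ _ := hbound n
      _ = _ := by
          congr 2
          rw [add_zero, mul_one, mul_div_assoc]
          congr 2
          push_cast
          ring
  · intro c _
    refine ⟨fun _ => 0, tendsto_const_nhds, ?_⟩
    set D : ℝ := ((numTChains p t : ℝ) - 1) / (p.choose (p / 2) : ℝ)
    have ht0 : t ≠ 0 := by omega
    have hs : (0 : ℝ) < (t : ℝ)⁻¹ := by positivity
    filter_upwards [eventually_add_mul_log_le_rpow (p - D * Real.logb 2 c + 1) (D / Real.log 2) hs,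
      eventually_gt_atTop 0] with k hk hk0
    have hR : (k : ℝ) ^ (t : ℝ)⁻¹ ≤ (strongBooleanRamsey k t (BoolLat p) : ℝ) + 1 := by
      have h : (k : ℝ) ≤ ((strongBooleanRamsey k t (BoolLat p) : ℝ) + 1) ^ t := by
        exact_mod_cast (lt_strongBooleanRamsey_succ_pow hk0 ht htp).le
      calc (k : ℝ) ^ (t : ℝ)⁻¹
          ≤ (((strongBooleanRamsey k t (BoolLat p) : ℝ) + 1) ^ t) ^ (t : ℝ)⁻¹ := by gcongr
        _ = _ := Real.pow_rpow_inv_natCast (by positivity) ht0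
    have hlog : D / Real.log 2 * Real.log k = D * Real.logb 2 k := by
      rw [Real.logb]; ring
    have heq : ((numTChains p t : ℝ) - 1) * (Real.logb 2 (k : ℝ) - Real.logb 2 c) /
        ((p.choose (p / 2) : ℝ) * (1 + 0)) = D * Real.logb 2 k - D * Real.logb 2 c := by
      simp only [D, add_zero, mul_one]; ring
    rw [heq]
    linarith
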